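/- Let $K$ be an algebraically closed field, $\Phi$ a finite dimensional $K$-algebra, $\mathscr{C}=\mathrm{mod}\,\Phi$ the abelian category of finitely generated right $\Phi$-modules, and $d\ge 1$ an integer. For an object $T$ of $\mathscr{C}$ let $\mathrm{add}(T)$ be the full subcategory of the direct summands of finite direct sums of copies of $T$. Assume that $\mathscr{T}=\mathrm{add}(T)$ is a $d$-cluster tilting subcategory of $\mathscr{C}$, that is, $\mathscr{T}$ is functorially finite in $\mathscr{C}$ and $$\mathscr{T}=\{a\in\mathscr{C}\mid \mathrm{Ext}^{i}_{\mathscr{C}}(t,a)=0 \text{ for all } t\in\mathscr{T},\ 1\le i\le d-1\}=\{a\in\mathscr{C}\mid \mathrm{Ext}^{i}_{\mathscr{C}}(a,t)=0 \text{ for all } t\in\mathscr{T},\ 1\le i\le d-1\}.$$ Let $\Lambda=\mathrm{End}_{\mathscr{C}}(T)$, let $\mathrm{mod}\,\Lambda$ be the category of finitely generated right $\Lambda$-modules, and let $\mathrm{proj}\,\Lambda$ be its full subcategory of projective modules. For an additive category $\mathscr{A}$ let $K_0^{\mathrm{sp}}(\mathscr{A})$ be the free abelian group on the isomorphism classes of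 objects of $\mathscr{A}$ modulo the relations $[A\oplus B]=[A]+[B]$. For $\mathscr{A}$ abelian let $K_0(\mathscr{A})$ be the quotient of $K_0^{\mathrm{sp}}(\mathscr{A})$ by the relations $[A]-[B]+[C]=0$ for all short exact sequences $0\to A\to B\to C\to 0$. Then: 1. the functor $\mathrm{Hom}_{\mathscr{C}}(T,-)\colon \mathscr{T}\to\mathrm{proj}\,\Lambda$ is an equivalence of categories; 2. the homomorphism $\rho\colon K_0^{\mathrm{sp}}(\mathrm{proj}\,\Lambda)\to K_0(\mathrm{mod}\,\Lambda)$ with $\rho([P])=[P]$ is an isomorphism; 3. the composition $\kappa=\rho\circ\mathrm{Hom}_{\mathscr{C}}(T,-)\colon K_0^{\mathrm{sp}}(\mathscr{T})\to K_0(\mathrm{mod}\,\Lambda)$, which satisfies $\kappa([t])=[\mathrm{Hom}_{\mathscr{C}}(T,t)]$ for all $t\in\mathscr{T}$, is an isomorphism. -/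

import Mathlib

open CategoryTheory CategoryTheory.Limits

universe w v u v' u'

noncomputable section

namespace HigherAuslander

section Grothendieck

variable (A : Type u) [Category.{v} A]

/-- The set of isomorphism classes of objects of `A`. -/
abbrev IsoClass : Type u := Quotient (isIsomorphicSetoid A)

variable {A} in
/-- The generator `[X]` of the free abelian group on the isomorphism classes of objects. -/
def freeClass (X : A) : FreeAbelianGroup (IsoClass A) :=
  FreeAbelianGroup.of (Quotient.mk (isIsomorphicSetoid A) X)

variable [Preadditive A]

/-- The subgroup generated by all `[X ⊕ Y] - [X] - [Y]`. A direct sum of `X` and `Y` is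
the apex of a biproduct diagram; as the classes only depend on objects up to isomorphism, it does
not matter that every such diagram is used and not a chosen one. -/
def splitRelations : AddSubgroup (FreeAbelianGroup (IsoClass A)) :=
  AddSubgroup.closure
    {z | ∃ (X Y : A) (b : BinaryBicone X Y), Nonempty b.IsBilimit ∧
      z = freeClass b.pt - freeClass X - freeClass Y}

/-- The split Grothendieck group of an additive category. -/
def K0sp : Type u := FreeAbelianGroup (IsoClass A) ⧸ splitRelations A

instance : AddCommGroup (K0sp A) :=
  inferInstanceAs (AddCommGroup (FreeAbelianGroup (IsoClass A) ⧸ splitRelations A))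

variable {A} in
/-- The class of an object in the split Grothendieck group. -/
def K0sp.of (X : A) : K0sp A :=
  QuotientAddGroup.mk' (splitRelations A) (freeClass X)

/-- The subgroup of the split Grothendieck group generated by all `[X] - [Y] + [Z]` for short exact
sequences `0 ⟶ X ⟶ Y ⟶ Z ⟶ 0`. -/
def exactRelations : AddSubgroup (K0sp A) :=
  AddSubgroup.closure
    {z | ∃ S : ShortComplex A, S.ShortExact ∧
      z = K0sp.of S.X₁ - K0sp.of S.X₂ + K0sp.of S.X₃}

/-- The Grothendieck group of an abelian category. (The abelian structure is a property of the
preadditive category `A` and is not needed in order to write down the group.) -/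
def K0 : Type u := K0sp A ⧸ exactRelations A

instance : AddCommGroup (K0 A) :=
  inferInstanceAs (AddCommGroup (K0sp A ⧸ exactRelations A))

/-- The canonical projection from the split Grothendieck group to the Grothendieck group. -/
def K0.proj : K0sp A →+ K0 A := QuotientAddGroup.mk' (exactRelations A)

variable {A} in
/-- The class of an object in the Grothendieck group. -/
def K0.of (X : A) : K0 A := K0.proj A (K0sp.of X)

variable {A} {B : Type u'} [Category.{v'} B] [Preadditive B]

/-- The map `[X] ↦ [F X]` on isomorphism classes that is induced by a functor. -/
def IsoClass.map (F : A ⥤ B) : IsoClass A → IsoClass B :=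
  Quotient.map F.obj fun _ _ ⟨e⟩ => ⟨F.mapIso e⟩

/-- The homomorphism `[X] ↦ [F X]` of split Grothendieck groups induced by an additive functor. -/
def K0sp.map (F : A ⥤ B) [F.Additive] : K0sp A →+ K0sp B :=
  QuotientAddGroup.map (splitRelations A) (splitRelations B)
    (FreeAbelianGroup.map (IsoClass.map F)) (by
      rw [splitRelations, AddSubgroup.closure_le]
      rintro _ ⟨X, Y, b, ⟨hb⟩, rfl⟩
      refine AddSubgroup.subset_closure ⟨F.obj X, F.obj Y, F.mapBinaryBicone b,
        ⟨isBinaryBilimitOfTotal _ ?_⟩, ?_⟩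
      · change F.map b.fst ≫ F.map b.inl + F.map b.snd ≫ F.map b.inr = 𝟙 (F.obj b.pt)
        rw [← F.map_comp, ← F.map_comp, ← F.map_add, IsBilimit.binary_total hb, F.map_id]
      simp only [map_sub]
      rfl)

end Grothendieck

section ClusterTilting

variable {A : Type u} [Category.{v} A]

/-- `add T`, as a property of objects: the direct summands of the finite direct sums of
copies of `T`. -/
def addClosure [Preadditive A] (T : A) : ObjectProperty A := fun X =>
  ∃ (n : ℕ) (b : Bicone fun _ : Fin n => T), Nonempty b.IsBilimit ∧ Nonempty (Retract X b.pt)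

/-- The vanishing of `Ext^i(X, Y)` in an abelian category. -/
def ExtVanishes [Abelian A] (X Y : A) (i : ℕ) : Prop :=
  letI := HasExt.standard A
  Subsingleton (Abelian.Ext.{max u v} X Y i)

/-- Every object has a right `P`-approximation. -/
def ContravariantlyFinite (P : ObjectProperty A) : Prop :=
  ∀ a : A, ∃ (t : A) (f : t ⟶ a), P t ∧
    ∀ (t' : A) (g : t' ⟶ a), P t' → ∃ h : t' ⟶ t, h ≫ f = g

/-- Every object has a left `P`-approximation. -/
def CovariantlyFinite (P : ObjectProperty A) : Prop :=
  ∀ a : A, ∃ (t : A) (f : a ⟶ t), P t ∧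
    ∀ (t' : A) (g : a ⟶ t'), P t' → ∃ h : t ⟶ t', f ≫ h = g

/-- The full subcategory of the objects with property `P` is a `d`-cluster tilting subcategory. -/
structure IsClusterTilting [Abelian A] (d : ℕ) (P : ObjectProperty A) : Prop where
  mem_iff_ext_to : ∀ a : A,
    P a ↔ ∀ t : A, P t → ∀ i : ℕ, 1 ≤ i → i + 1 ≤ d → ExtVanishes t a i
  mem_iff_ext_from : ∀ a : A,
    P a ↔ ∀ t : A, P t → ∀ i : ℕ, 1 ≤ i → i + 1 ≤ d → ExtVanishes a t i
  contravariantlyFinite : ContravariantlyFinite P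
  covariantlyFinite : CovariantlyFinite P

end ClusterTilting

/-- The finitely generated projective modules over a ring `R`, inside the category of finitely
generated `R`-modules. -/
def isProj (R : Type u) [Ring R] : ObjectProperty (FGModuleCat.{u} R) :=
  fun M => Module.Projective R M

/-- The homomorphism `ρ : K₀ˢᵖ(proj R) → K₀(mod R)`, `[P] ↦ [P]`. -/
def rho (R : Type u) [Ring R] : K0sp (isProj R).FullSubcategory →+ K0 (FGModuleCat.{u} R) :=
  (K0.proj (FGModuleCat.{u} R)).comp (K0sp.map (isProj R).ι)

section Hom

variable {C : Type u} [Category.{v} C] [Preadditive C] (T : C)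

/-- `Hom(T, X)` is a direct summand of a finite free right `End T`-module if `X` is
in `add T`. -/
lemma exists_split (X : C) (hX : addClosure T X) :
    ∃ (n : ℕ) (i : (preadditiveCoyonedaObj T).obj X →ₗ[(End T)ᵐᵒᵖ] (Fin n → (End T)ᵐᵒᵖ))
      (r : (Fin n → (End T)ᵐᵒᵖ) →ₗ[(End T)ᵐᵒᵖ] (preadditiveCoyonedaObj T).obj X),
      r ∘ₗ i = LinearMap.id := by
  obtain ⟨n, b, ⟨hb⟩, ⟨e⟩⟩ := hX
  refine ⟨n,
    { toFun := fun g j => MulOpposite.op (show T ⟶ T from (show T ⟶ X from g) ≫ e.i ≫ b.π j)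
      map_add' := ?_
      map_smul' := ?_ },
    { toFun := fun a => (∑ j, (show T ⟶ T from (a j).unop) ≫ b.ι j ≫ e.r : T ⟶ X)
      map_add' := ?_
      map_smul' := ?_ }, ?_⟩
  · intro x y
    funext j
    apply MulOpposite.unop_injective
    exact Preadditive.add_comp _ _ _ _ _ _
  · intro c x
    funext j
    apply MulOpposite.unop_injective
    exact Category.assoc _ _ _
  · intro x y
    refine Eq.trans ?_ Finset.sum_add_distrib
    exact Finset.sum_congr rfl fun j _ => Preadditive.add_comp _ _ _ _ _ _
  · intro c x
    refine Eq.trans ?_ (Preadditive.comp_sum Finset.univ (show T ⟶ T from c.unop)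
      fun j => (show T ⟶ T from (x j).unop) ≫ b.ι j ≫ e.r).symm
    exact Finset.sum_congr rfl fun j _ => Category.assoc _ _ _
  · refine LinearMap.ext fun g => ?_
    change (∑ j, ((show T ⟶ X from g) ≫ e.i ≫ b.π j) ≫ b.ι j ≫ e.r : T ⟶ X) = g
    have h : ∀ j, ((show T ⟶ X from g) ≫ e.i ≫ b.π j) ≫ b.ι j ≫ e.r =
        ((show T ⟶ X from g) ≫ e.i) ≫ (b.π j ≫ b.ι j) ≫ e.r := by
      intro j
      refine (Category.assoc _ _ _).trans (Eq.trans ?_ (Category.assoc _ _ _).symm)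
      simp only [Category.assoc]
    rw [Finset.sum_congr rfl fun j _ => h j, ← Preadditive.comp_sum, ← Preadditive.sum_comp,
      IsBilimit.total hb, Category.id_comp]
    exact (Category.assoc _ _ _).trans ((congrArg _ e.retract).trans (Category.comp_id _))

lemma finite_hom (X : C) (hX : addClosure T X) :
    Module.Finite (End T)ᵐᵒᵖ ((preadditiveCoyonedaObj T).obj X) := by
  obtain ⟨n, i, r, h⟩ := exists_split T X hX
  exact Module.Finite.of_surjective r fun x => ⟨i x, LinearMap.congr_fun h x⟩

lemma projective_hom (X : C) (hX : addClosure T X) :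
    Module.Projective (End T)ᵐᵒᵖ ((preadditiveCoyonedaObj T).obj X) := by
  obtain ⟨n, i, r, h⟩ := exists_split T X hX
  exact Module.Projective.of_split i r h

/-- The functor `Hom(T, -)` from `add T` to the category of finitely generated
right `End T`-modules. Right modules are modules over the opposite ring; the product of `End T` is
composition of functions, and `End T` acts on `Hom(T, X)` by precomposition. -/
def homMod : (addClosure T).FullSubcategory ⥤ FGModuleCat.{v} (End T)ᵐᵒᵖ :=
  (ModuleCat.isFG (End T)ᵐᵒᵖ).lift ((addClosure T).ι ⋙ preadditiveCoyonedaObj T)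
    fun X => finite_hom T X.obj X.property

instance : (homMod T).Additive :=
  by
  refine { map_add := fun {X Y f g} => ?_ }
  apply FGModuleCat.hom_ext
  refine LinearMap.ext fun h => ?_
  exact Preadditive.comp_add _ _ _ _ _ _

/-- The functor `Hom(T, -)` from `add T` to `proj (End T)`. -/
def homProj : (addClosure T).FullSubcategory ⥤ (isProj (End T)ᵐᵒᵖ).FullSubcategory :=
  (isProj (End T)ᵐᵒᵖ).lift (homMod T) fun X => projective_hom T X.obj X.property

instance : (homProj T).Additive :=
  by
  refine { map_add := fun {X Y f g} => ?_ }
  exact ObjectProperty.hom_ext _ ((homMod T).map_add)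

/-- The composition `κ = ρ ∘ Hom(T, -)`. -/
def kappa : K0sp (addClosure T).FullSubcategory →+ K0 (FGModuleCat.{v} (End T)ᵐᵒᵖ) :=
  (rho (End T)ᵐᵒᵖ).comp (K0sp.map (homProj T))

end Hom

end HigherAuslander

end

/-!
Write `H = Hom(T, -)` and `Λ = End T`; right `Λ`-modules are modules over `(End T)ᵐᵒᵖ`.

*The equivalence.* Morphisms out of an object of `add T` are determined by their effect on `H`, and
every linear map is such an effect, because the identity of the object is a sum of morphisms that
factor through `T` (`bijective_preadditiveCoyonedaObj_map`). A finitely generated projective module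
is a direct summand of some `H Y`, so it is cut out by an idempotent of `Y`, which splits.

*The Grothendieck groups.* The algebra `Λ` is finite-dimensional, hence Noetherian, and every
finitely generated `Λ`-module `M` has a projective resolution of length `d + 1`
(`exists_isEulerClass`): present `M` by a morphism `H t₁ ⟶ H t₀`, which is `H f` for some
`f : t₁ ⟶ t₀`; its kernel is `H (ker f)`. Now take successive right `add T`-approximations, starting
at `a = ker f`. They are epimorphisms, as `add T` contains the projective objects, and they stay so
under `H`. By dimension shifting, each kernel satisfies one more of the conditions
`Ext^i(t, a) = 0` than the previous object, so after `d - 1` steps the kernel is in `add T`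
(`exists_isEulerClass_hom`).

The inverse of `ρ` sends a module to the alternating sum of the terms of a projective resolution,
its Euler class. That this is well defined and additive on short exact sequences follows from a
single construction (`exists_shortExact_biprod`): if `X ⟶ Y ⟶ Z` is short exact and `Q ⟶ Z` is an
epimorphism from a projective object with kernel `K`, then there is a short exact sequence
`K ⟶ X ⊞ Q ⟶ Y`. Using it three times replaces `X`, `Y` and `Z` by their syzygies, up to projective
summands, and gives an induction on the length of the resolutions (`IsEulerClass.add`).
-/

namespace HigherAuslander

/-! ### Relations in Grothendieck groups -/

section Relations

variable {A : Type u} [Category.{v} A] [Preadditive A]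

lemma K0sp.of_eq_of_iso {X Y : A} (e : X ≅ Y) : K0sp.of X = K0sp.of Y :=
  congrArg (fun c : IsoClass A =>
    QuotientAddGroup.mk' (splitRelations A) (FreeAbelianGroup.of c)) (Quotient.sound ⟨e⟩)

lemma K0sp.of_bicone {X Y : A} (b : BinaryBicone X Y) (hb : b.IsBilimit) :
    K0sp.of b.pt = K0sp.of X + K0sp.of Y := by
  rw [← sub_eq_zero, ← sub_sub]
  exact (QuotientAddGroup.eq_zero_iff _).2
    (AddSubgroup.subset_closure ⟨X, Y, b, ⟨hb⟩, rfl⟩)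

lemma K0sp.hom_ext {G : Type*} [AddCommGroup G] {f g : K0sp A →+ G}
    (h : ∀ X : A, f (K0sp.of X) = g (K0sp.of X)) : f = g := by
  refine QuotientAddGroup.addMonoidHom_ext _ (FreeAbelianGroup.lift_ext _ _ fun c => ?_)
  obtain ⟨X, rfl⟩ := Quotient.exists_rep c
  exact h X

lemma K0.hom_ext {G : Type*} [AddCommGroup G] {f g : K0 A →+ G}
    (h : ∀ X : A, f (K0.of X) = g (K0.of X)) : f = g :=
  QuotientAddGroup.addMonoidHom_ext _ (K0sp.hom_ext h)

/-- A sequence of objects with property `P` that splits in the ambient category gives a relation in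
the split Grothendieck group of the full subcategory. -/
lemma K0sp.of_splitting (P : ObjectProperty A) {S : ShortComplex A} (s : S.Splitting)
    (h₁ : P S.X₁) (h₂ : P S.X₂) (h₃ : P S.X₃) :
    (K0sp.of ⟨S.X₂, h₂⟩ : K0sp P.FullSubcategory) =
      K0sp.of ⟨S.X₁, h₁⟩ + K0sp.of ⟨S.X₃, h₃⟩ := by
  let b : BinaryBicone (⟨S.X₁, h₁⟩ : P.FullSubcategory) ⟨S.X₃, h₃⟩ :=
    { pt := ⟨S.X₂, h₂⟩
      fst := P.homMk s.r
      snd := P.homMk S.g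
      inl := P.homMk S.f
      inr := P.homMk s.s
      inl_fst := ObjectProperty.hom_ext _ s.f_r
      inl_snd := ObjectProperty.hom_ext _ S.zero
      inr_fst := ObjectProperty.hom_ext _ s.s_r
      inr_snd := ObjectProperty.hom_ext _ s.s_g }
  exact K0sp.of_bicone b (isBinaryBilimitOfTotal b (ObjectProperty.hom_ext _ s.id))

lemma K0sp.of_isZero (P : ObjectProperty A) {X : A} (hX : IsZero X) (h : P X) :
    (K0sp.of ⟨X, h⟩ : K0sp P.FullSubcategory) = 0 := by
  let S : ShortComplex A := ShortComplex.mk (0 : X ⟶ X) (0 : X ⟶ X) (by simp)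
  have s : S.Splitting := { r := 0, s := 0, f_r := hX.eq_of_src _ _, s_g := hX.eq_of_src _ _,
                            id := hX.eq_of_src _ _ }
  exact left_eq_add.1 (K0sp.of_splitting P s h h h)

lemma K0.of_shortExact {S : ShortComplex A} (hS : S.ShortExact) :
    K0.of S.X₂ = K0.of S.X₁ + K0.of S.X₃ := by
  have h : K0.proj A (K0sp.of S.X₁ - K0sp.of S.X₂ + K0sp.of S.X₃) = 0 :=
    (QuotientAddGroup.eq_zero_iff _).2 (AddSubgroup.subset_closure ⟨S, hS, rfl⟩)
  rw [map_add, map_sub, sub_add_eq_add_sub, sub_eq_zero] at h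
  exact h.symm

end Relations

/-! ### Euler classes of projective resolutions -/

section Resolution

variable {A : Type u} [Category.{v} A] [Abelian A]

/-- A function on objects that is additive on short exact sequences factors through the
Grothendieck group. -/
lemma K0.exists_lift {G : Type*} [AddCommGroup G]
    (φ : A → G) (hφ : ∀ S : ShortComplex A, S.ShortExact → φ S.X₂ = φ S.X₁ + φ S.X₃) :
    ∃ χ : K0 A →+ G, ∀ X, χ (K0.of X) = φ X := by
  have hz : ∀ X : A, IsZero X → φ X = 0 := by
    intro X hX
    let S : ShortComplex A := ShortComplex.mk (0 : X ⟶ X) (0 : X ⟶ X) (by simp)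
    have s : S.Splitting := { r := 0, s := 0, f_r := hX.eq_of_src _ _, s_g := hX.eq_of_src _ _,
                              id := hX.eq_of_src _ _ }
    exact left_eq_add.1 (hφ S s.shortExact)
  have hiso : ∀ X Y : A, (X ≅ Y) → φ X = φ Y := by
    intro X Y e
    obtain ⟨Z, hZ⟩ := HasZeroObject.zero (C := A)
    let S : ShortComplex A := ShortComplex.mk (0 : Z ⟶ X) e.hom (by simp)
    have s : S.Splitting := .ofIsZeroOfIsIso S hZ (inferInstanceAs (IsIso e.hom))
    have := hφ S s.shortExact
    rwa [hz S.X₁ hZ, zero_add] at this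
  let ψ : FreeAbelianGroup (IsoClass A) →+ G :=
    FreeAbelianGroup.lift (Quotient.lift φ fun X Y ⟨e⟩ => hiso X Y e)
  have hψ : ∀ X : A, ψ (freeClass X) = φ X := fun X => FreeAbelianGroup.lift_apply_of _ _
  let χ₀ : K0sp A →+ G := QuotientAddGroup.lift (splitRelations A) ψ (by
    rw [splitRelations, AddSubgroup.closure_le]
    rintro _ ⟨X, Y, b, ⟨hb⟩, rfl⟩
    let S : ShortComplex A := ShortComplex.mk b.inl b.snd b.inl_snd
    have s : S.Splitting := { r := b.fst, s := b.inr, f_r := b.inl_fst, s_g := b.inr_snd,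
                              id := IsBilimit.binary_total hb }
    change ψ _ = 0
    rw [map_sub, map_sub, hψ, hψ, hψ, sub_sub, sub_eq_zero]
    exact hφ S s.shortExact)
  have hχ₀ : ∀ X : A, χ₀ (K0sp.of X) = φ X := hψ
  refine ⟨QuotientAddGroup.lift (exactRelations A) χ₀ ?_, hψ⟩
  rw [exactRelations, AddSubgroup.closure_le]
  rintro _ ⟨S, hS, rfl⟩
  change χ₀ _ = 0
  rw [map_add, map_sub, sub_add_eq_add_sub, sub_eq_zero, hχ₀, hχ₀, hχ₀]
  exact (hφ S hS).symm

/-- If a projective object `Q` maps onto the end of a short exact sequence `X ⟶ Y ⟶ Z` with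
kernel `K`, then lifting gives a short exact sequence `K ⟶ X ⊞ Q ⟶ Y`. -/
lemma exists_shortExact_biprod {K Q X Y Z : A} [Projective Q]
    {k : K ⟶ Q} {q : Q ⟶ Z} {wq : k ≫ q = 0} (hq : (ShortComplex.mk k q wq).ShortExact)
    {f : X ⟶ Y} {g : Y ⟶ Z} {wg : f ≫ g = 0} (hg : (ShortComplex.mk f g wg).ShortExact) :
    ∃ (i : K ⟶ X ⊞ Q) (p : X ⊞ Q ⟶ Y) (w : i ≫ p = 0),
      (ShortComplex.mk i p w).ShortExact := by
  have : Mono f := hg.mono_f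
  have : Epi g := hg.epi_g
  have : Mono k := hq.mono_f
  have : Epi q := hq.epi_g
  -- The maps are `(m, -k)` and `(f, l)`, with `l` a lift of `q` to `Y` and `m` its restriction to
  -- the kernels.
  let l : Q ⟶ Y := Projective.factorThru q g
  have hl : l ≫ g = q := Projective.factorThru_comp _ _
  let m : K ⟶ X := hg.exact.lift (k ≫ l) (by simp [hl, wq])
  have hm : m ≫ f = k ≫ l := hg.exact.lift_f _ _
  have w : biprod.lift m (-k) ≫ biprod.desc f l = 0 := by simp [hm]
  have hi : Mono (biprod.lift m (-k)) := by
    have : Mono (biprod.lift m (-k) ≫ (biprod.snd : X ⊞ Q ⟶ _)) := by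
      rw [biprod.lift_snd]; infer_instance
    exact mono_of_mono _ biprod.snd
  refine ⟨biprod.lift m (-k), biprod.desc f l, w, .mk' ?_ hi ?_⟩
  · have hx' : ∀ {W : A} (x : W ⟶ X ⊞ Q), x ≫ biprod.desc f l = 0 →
        x ≫ biprod.fst ≫ f + x ≫ biprod.snd ≫ l = 0 := by
      intro W x hx
      rw [← Preadditive.comp_add, ← biprod.desc_eq, hx]
    have hk : ∀ {W : A} (x : W ⟶ X ⊞ Q), x ≫ biprod.desc f l = 0 →
        (-(x ≫ biprod.snd)) ≫ q = 0 := by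
      intro W x hx
      have := congrArg (· ≫ g) (hx' x hx)
      simpa [wg, hl] using this
    refine ShortComplex.exact_of_f_is_kernel _ (KernelFork.IsLimit.ofι' _ _ fun {W} x hx =>
      ⟨hq.exact.lift (-(x ≫ biprod.snd)) (hk x hx), ?_⟩)
    have hu : hq.exact.lift (-(x ≫ biprod.snd)) (hk x hx) ≫ k = -(x ≫ biprod.snd) :=
      hq.exact.lift_f _ _
    apply biprod.hom_ext
    · rw [← cancel_mono f]
      simp only [Category.assoc, biprod.lift_fst, hm]
      rw [reassoc_of% hu, Preadditive.neg_comp, Category.assoc]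
      exact (eq_neg_of_add_eq_zero_left (hx' x hx)).symm
    · simp [hu]
  · refine Preadditive.epi_of_cancel_zero _ fun {W} (h : Y ⟶ W) hh => ?_
    have h₁ : f ≫ h = 0 := by simpa using congrArg (biprod.inl ≫ ·) hh
    have h₂ : l ≫ h = 0 := by simpa using congrArg (biprod.inr ≫ ·) hh
    have h₃ : g ≫ hg.exact.desc h h₁ = h := hg.exact.g_desc _ _
    have h₄ : q ≫ hg.exact.desc h h₁ = 0 := by
      rw [← hl, Category.assoc, h₃, h₂]
    rw [← h₃, zero_of_epi_comp q h₄, comp_zero]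

/-- `IsEulerClass P n X x` says that `X` has a resolution of length `n` by objects with property
`P`, and that `x` is the alternating sum of the classes of the terms of this resolution. -/
def IsEulerClass (P : ObjectProperty A) : ℕ → A → K0sp P.FullSubcategory → Prop
  | 0, X, x => ∃ h : P X, x = K0sp.of ⟨X, h⟩
  | n + 1, X, x => ∃ (K Q : A) (i : K ⟶ Q) (p : Q ⟶ X) (w : i ≫ p = 0) (hQ : P Q)
      (y : K0sp P.FullSubcategory), (ShortComplex.mk i p w).ShortExact ∧
        IsEulerClass P n K y ∧ x = K0sp.of ⟨Q, hQ⟩ - y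

variable {P : ObjectProperty A}

lemma isEulerClass_of_prop (hP : ∀ X, P X ↔ Projective X) (n : ℕ) {X : A} (hX : P X) :
    IsEulerClass P n X (K0sp.of ⟨X, hX⟩) := by
  induction n generalizing X with
  | zero => exact ⟨hX, rfl⟩
  | succ n ih =>
    obtain ⟨Z, hZ⟩ := HasZeroObject.zero (C := A)
    have hPZ : P Z := (hP Z).2 hZ.projective
    refine ⟨Z, X, 0, 𝟙 X, by simp, hX, _, ?_, ih hPZ, ?_⟩
    · exact (ShortComplex.Splitting.ofIsZeroOfIsIso _ hZ
        (inferInstanceAs (IsIso (𝟙 X)))).shortExact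
    · rw [K0sp.of_isZero P hZ, sub_zero]

lemma exists_of_biprod_eq (hP : ∀ X, P X ↔ Projective X) {X Y : A} (hX : P X) (hY : P Y) :
    ∃ h : P (X ⊞ Y), (K0sp.of ⟨X ⊞ Y, h⟩ : K0sp P.FullSubcategory) =
      K0sp.of ⟨X, hX⟩ + K0sp.of ⟨Y, hY⟩ := by
  have := (hP X).1 hX
  have := (hP Y).1 hY
  have h : P (X ⊞ Y) := (hP _).2 inferInstance
  exact ⟨h, K0sp.of_splitting P (ShortComplex.Splitting.ofHasBinaryBiproduct X Y) hX h hY⟩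

lemma exists_shortExact_biprod_right {K R X : A} {i : K ⟶ R} {p : R ⟶ X} {w : i ≫ p = 0}
    (hS : (ShortComplex.mk i p w).ShortExact) (Q : A) :
    ∃ (i' : K ⟶ R ⊞ Q) (p' : R ⊞ Q ⟶ X ⊞ Q) (w' : i' ≫ p' = 0),
      (ShortComplex.mk i' p' w').ShortExact := by
  have hi : Mono i := hS.mono_f
  have hp : Epi p := hS.epi_g
  have w' : (i ≫ (biprod.inl : R ⟶ R ⊞ Q)) ≫ biprod.map p (𝟙 Q) = 0 := by
    simp [reassoc_of% w]
  refine ⟨i ≫ biprod.inl, biprod.map p (𝟙 Q), w', .mk' ?_ (mono_comp _ _)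
    (inferInstanceAs (Epi (biprod.map p (𝟙 Q))))⟩
  have h₁ : ∀ {W : A} (a : W ⟶ R ⊞ Q), a ≫ biprod.map p (𝟙 Q) = 0 →
      (a ≫ biprod.fst) ≫ p = 0 := by
    intro W a ha
    simpa using congrArg (· ≫ biprod.fst) ha
  refine ShortComplex.exact_of_f_is_kernel _ (KernelFork.IsLimit.ofι' _ _ fun {W} a ha =>
    ⟨hS.exact.lift (a ≫ biprod.fst) (h₁ a ha), ?_⟩)
  have hu : hS.exact.lift (a ≫ biprod.fst) (h₁ a ha) ≫ i = a ≫ biprod.fst := hS.exact.lift_f _ _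
  have h₀ : a ≫ biprod.snd = 0 := by simpa using congrArg (· ≫ biprod.snd) ha
  apply biprod.hom_ext
  · simp [reassoc_of% hu]
  · simp [h₀]

lemma IsEulerClass.biprod (hP : ∀ X, P X ↔ Projective X) {n : ℕ} {X Q : A}
    {x : K0sp P.FullSubcategory} (hx : IsEulerClass P n X x) (hQ : P Q) :
    IsEulerClass P n (X ⊞ Q) (x + K0sp.of ⟨Q, hQ⟩) := by
  cases n with
  | zero =>
    obtain ⟨hX, rfl⟩ := hx
    obtain ⟨h, e⟩ := exists_of_biprod_eq hP hX hQ
    exact ⟨h, e.symm⟩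
  | succ n =>
    obtain ⟨K, R, i, p, w, hR, y, hS, hy, rfl⟩ := hx
    obtain ⟨h, e⟩ := exists_of_biprod_eq hP hR hQ
    obtain ⟨i', p', w', hS'⟩ := exists_shortExact_biprod_right hS Q
    exact ⟨K, R ⊞ Q, i', p', w', h, y, hS', hy, by rw [e]; abel⟩

/-- Euler classes of projective resolutions of the same length are additive on short exact
sequences. Each of the three rotations of the sequence replaces the last term by a syzygy of it, so
that after three steps all terms have resolutions that are shorter by one. -/
lemma IsEulerClass.add (hP : ∀ X, P X ↔ Projective X) {n : ℕ} {X Y Z : A} {f : X ⟶ Y} {g : Y ⟶ Z}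
    {w : f ≫ g = 0} (hS : (ShortComplex.mk f g w).ShortExact) {x y z : K0sp P.FullSubcategory}
    (hx : IsEulerClass P n X x) (hy : IsEulerClass P n Y y) (hz : IsEulerClass P n Z z) :
    y = x + z := by
  induction n generalizing X Y Z x y z with
  | zero =>
    obtain ⟨hX, rfl⟩ := hx
    obtain ⟨hY, rfl⟩ := hy
    obtain ⟨hZ, rfl⟩ := hz
    have : Projective (ShortComplex.mk f g w).X₃ := (hP Z).1 hZ
    exact K0sp.of_splitting P hS.splittingOfProjective hX hY hZ
  | succ n ih =>
    obtain ⟨KX, QX, iX, pX, wX, hQX, kx, hSX, hkx, rfl⟩ := hx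
    obtain ⟨KY, QY, iY, pY, wY, hQY, ky, hSY, hky, rfl⟩ := hy
    obtain ⟨KZ, QZ, iZ, pZ, wZ, hQZ, kz, hSZ, hkz, rfl⟩ := hz
    have := (hP QX).1 hQX
    have := (hP QY).1 hQY
    have := (hP QZ).1 hQZ
    -- The sequences `KZ ⟶ X ⊞ QZ ⟶ Y`, `KY ⟶ KZ ⊞ QY ⟶ X ⊞ QZ` and, from the syzygy `KX` of
    -- `X ⊞ QZ`, finally `KX ⟶ KY ⊞ (QX ⊞ QZ) ⟶ KZ ⊞ QY`.
    obtain ⟨_, _, _, h₁⟩ := exists_shortExact_biprod hSZ hS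
    obtain ⟨_, _, _, h₂⟩ := exists_shortExact_biprod hSY h₁
    obtain ⟨_, _, _, h₃⟩ := exists_shortExact_biprod_right hSX QZ
    obtain ⟨_, _, _, h₄⟩ := exists_shortExact_biprod h₃ h₂
    obtain ⟨hQ, e⟩ := exists_of_biprod_eq hP hQX hQZ
    have h := ih h₄ hkx (hky.biprod hP hQ) (hkz.biprod hP hQY)
    rw [e] at h
    rw [← sub_eq_zero] at h ⊢
    rw [← neg_eq_zero, ← h]
    abel

lemma IsEulerClass.proj_eq {n : ℕ} {X : A} {x : K0sp P.FullSubcategory}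
    (hx : IsEulerClass P n X x) : K0.proj A (K0sp.map P.ι x) = K0.of X := by
  induction n generalizing X x with
  | zero =>
    obtain ⟨hX, rfl⟩ := hx
    rfl
  | succ n ih =>
    obtain ⟨K, Q, i, p, w, hQ, y, hS, hy, rfl⟩ := hx
    have e : K0.of Q = K0.of K + K0.of X := K0.of_shortExact hS
    rw [map_sub, map_sub, ih hy, sub_eq_iff_eq_add']
    exact e

/-- The Grothendieck group of an abelian category in which all objects have projective resolutions
of length `n` is the split Grothendieck group of its projective objects; the inverse map sends an
object to its Euler class. -/
theorem bijective_proj_comp_map (hP : ∀ X, P X ↔ Projective X) (n : ℕ)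
    (hn : ∀ X, ∃ x, IsEulerClass P n X x) :
    Function.Bijective ((K0.proj A).comp (K0sp.map P.ι)) := by
  choose φ hφ using hn
  obtain ⟨χ, hχ⟩ := K0.exists_lift φ fun S hS =>
    IsEulerClass.add hP hS (hφ S.X₁) (hφ S.X₂) (hφ S.X₃)
  -- Additivity on `Q ⟶ Q ⟶ 0` compares the chosen resolution of `Q` with the trivial one.
  have hφP : ∀ Q (hQ : P Q), φ Q = K0sp.of ⟨Q, hQ⟩ := by
    intro Q hQ
    obtain ⟨Z, hZ⟩ := HasZeroObject.zero (C := A)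
    have hS : (ShortComplex.mk (𝟙 Q) (0 : Q ⟶ Z) (by simp)).ShortExact :=
      (ShortComplex.Splitting.ofIsIsoOfIsZero _ (inferInstanceAs (IsIso (𝟙 Q))) hZ).shortExact
    have hPZ : P Z := (hP Z).2 hZ.projective
    have h := IsEulerClass.add hP hS (hφ Q) (isEulerClass_of_prop hP n hQ)
      (isEulerClass_of_prop hP n hPZ)
    rw [K0sp.of_isZero P hZ, add_zero] at h
    exact h.symm
  have h₁ : χ.comp ((K0.proj A).comp (K0sp.map P.ι)) = AddMonoidHom.id _ :=
    K0sp.hom_ext fun X => (hχ X.obj).trans (hφP X.obj X.property)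
  have h₂ : ((K0.proj A).comp (K0sp.map P.ι)).comp χ = AddMonoidHom.id _ :=
    K0.hom_ext fun X =>
      (congrArg ((K0.proj A).comp (K0sp.map P.ι)) (hχ X)).trans (hφ X).proj_eq
  exact ⟨Function.LeftInverse.injective (DFunLike.congr_fun h₁),
    Function.RightInverse.surjective (DFunLike.congr_fun h₂)⟩

end Resolution

lemma K0sp.bijective_map_of_isEquivalence {C : Type u} [Category.{v} C] [Preadditive C]
    {D : Type u'} [Category.{v'} D] [Preadditive D] (F : C ⥤ D) [F.Additive] [F.IsEquivalence] :
    Function.Bijective (K0sp.map F) := by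
  have hF : F.asEquivalence.functor.Additive := ‹F.Additive›
  have h₁ : (K0sp.map F.asEquivalence.inverse).comp (K0sp.map F) = AddMonoidHom.id _ :=
    K0sp.hom_ext fun X => K0sp.of_eq_of_iso (F.asEquivalence.unitIso.app X).symm
  have h₂ : (K0sp.map F).comp (K0sp.map F.asEquivalence.inverse) = AddMonoidHom.id _ :=
    K0sp.hom_ext fun X => K0sp.of_eq_of_iso (F.asEquivalence.counitIso.app X)
  exact ⟨Function.LeftInverse.injective (DFunLike.congr_fun h₁),
    Function.RightInverse.surjective (DFunLike.congr_fun h₂)⟩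

/-! ### Finitely generated modules over a Noetherian ring -/

section FGModuleCat

variable {R : Type u} [Ring R] [IsNoetherianRing R]

lemma _root_.FGModuleCat.surjective_of_epi {M N : FGModuleCat.{u} R} (f : M ⟶ N) [Epi f] :
    Function.Surjective f.hom.hom :=
  (ModuleCat.epi_iff_surjective _).1
    (inferInstanceAs (Epi ((forget₂ (FGModuleCat.{u} R) (ModuleCat.{u} R)).map f)))

lemma _root_.FGModuleCat.epi_of_surjective {M N : FGModuleCat.{u} R} (f : M ⟶ N)
    (hf : Function.Surjective f.hom.hom) : Epi f := by
  have : Epi ((forget₂ (FGModuleCat.{u} R) (ModuleCat.{u} R)).map f) :=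
    (ModuleCat.epi_iff_surjective _).2 hf
  exact (forget₂ (FGModuleCat.{u} R) (ModuleCat.{u} R)).epi_of_epi_map this

lemma _root_.FGModuleCat.shortExact {M N L : FGModuleCat.{u} R} {f : M ⟶ N} {g : N ⟶ L}
    (w : f ≫ g = 0)
    (hf : Function.Injective f.hom.hom) (hg : Function.Surjective g.hom.hom)
    (h : ∀ x, g.hom.hom x = 0 → ∃ y, f.hom.hom y = x) : (ShortComplex.mk f g w).ShortExact := by
  have : Mono ((forget₂ (FGModuleCat.{u} R) (ModuleCat.{u} R)).map f) :=
    (ModuleCat.mono_iff_injective _).2 hf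
  refine .mk' ?_ ((forget₂ (FGModuleCat.{u} R) (ModuleCat.{u} R)).mono_of_mono_map this)
    (FGModuleCat.epi_of_surjective g hg)
  rw [← ShortComplex.exact_map_iff_of_faithful _ (forget₂ (FGModuleCat.{u} R) (ModuleCat.{u} R)),
    ShortComplex.moduleCat_exact_iff]
  exact h

lemma _root_.FGModuleCat.exists_epi_free (M : FGModuleCat.{u} R) :
    ∃ (n : ℕ) (f : FGModuleCat.of R (Fin n → R) ⟶ M), Epi f := by
  obtain ⟨n, f, hf⟩ := Module.Finite.exists_fin' R M
  exact ⟨n, FGModuleCat.ofHom f, FGModuleCat.epi_of_surjective _ hf⟩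

lemma isProj_iff_projective (M : FGModuleCat.{u} R) : isProj R M ↔ Projective M := by
  constructor
  · intro (h : Module.Projective R M)
    refine ⟨fun {E X} f e he => ?_⟩
    obtain ⟨l, hl⟩ := Module.projective_lifting_property e.hom.hom f.hom.hom
      (FGModuleCat.surjective_of_epi e)
    exact ⟨FGModuleCat.ofHom l, FGModuleCat.hom_ext hl⟩
  · intro h
    obtain ⟨n, f, hf⟩ := FGModuleCat.exists_epi_free M
    have e := Projective.factorThru_comp (𝟙 M) f
    exact Module.Projective.of_split (Projective.factorThru (𝟙 M) f).hom.hom f.hom.hom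
      (congrArg (fun g => g.hom.hom) e)

instance : EnoughProjectives (FGModuleCat.{u} R) where
  presentation M := by
    obtain ⟨n, f, hf⟩ := FGModuleCat.exists_epi_free M
    have : Projective (FGModuleCat.of R (Fin n → R)) :=
      (isProj_iff_projective _).1 (inferInstanceAs (Module.Projective R (Fin n → R)))
    exact ⟨{ p := _, f := f }⟩

end FGModuleCat

/-! ### The functor `Hom(T, -)` on `add T` -/

section AddClosure

variable {C : Type u} [Category.{v} C] [Preadditive C] {T : C}

lemma addClosure_exists_sum {X : C} (hX : addClosure T X) :
    ∃ (n : ℕ) (p : Fin n → (X ⟶ T)) (q : Fin n → (T ⟶ X)), ∑ j, p j ≫ q j = 𝟙 X := by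
  obtain ⟨n, b, ⟨hb⟩, ⟨e⟩⟩ := hX
  refine ⟨n, fun j => e.i ≫ b.π j, fun j => b.ι j ≫ e.r, ?_⟩
  have h : ∀ j, (e.i ≫ b.π j) ≫ b.ι j ≫ e.r = e.i ≫ (b.π j ≫ b.ι j) ≫ e.r := by simp
  rw [Finset.sum_congr rfl fun j _ => h j, ← Preadditive.comp_sum, ← Preadditive.sum_comp,
    IsBilimit.total hb, Category.id_comp, e.retract]

/-- For `X` in `add T`, every linear map `Hom(T, X) → Hom(T, Y)` is composition with a unique
morphism `X ⟶ Y`. -/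
lemma bijective_preadditiveCoyonedaObj_map {X : C} (hX : addClosure T X) (Y : C) :
    Function.Bijective ((preadditiveCoyonedaObj T).map : (X ⟶ Y) → _) := by
  obtain ⟨n, p, q, h⟩ := addClosure_exists_sum hX
  constructor
  · intro f g hfg
    have hq : ∀ j, q j ≫ f = q j ≫ g := fun j =>
      LinearMap.congr_fun (congrArg ModuleCat.Hom.hom hfg) (q j)
    rw [← Category.id_comp f, ← Category.id_comp g, ← h, Preadditive.sum_comp,
      Preadditive.sum_comp]
    simp only [Category.assoc, hq]
  · intro φ
    have hlin : ∀ (c : T ⟶ T) (g : T ⟶ X), φ.hom (c ≫ g : T ⟶ X) = (c ≫ φ.hom g : T ⟶ Y) :=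
      fun c g => φ.hom.map_smul (MulOpposite.op (End.of c)) g
    -- If `𝟙 X = ∑ p j ≫ q j`, the morphism is forced to be `∑ p j ≫ φ (q j)`.
    refine ⟨∑ j, p j ≫ φ.hom (q j), ModuleCat.hom_ext (LinearMap.ext fun (g : T ⟶ X) => ?_)⟩
    change (g ≫ ∑ j, p j ≫ φ.hom (q j) : T ⟶ Y) = φ.hom g
    have hg : g = ∑ j, (g ≫ p j) ≫ q j := by
      simp only [Category.assoc]
      rw [← Preadditive.comp_sum, h, Category.comp_id]
    conv_rhs => rw [hg]
    rw [Preadditive.comp_sum]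
    refine Eq.trans ?_ (map_sum φ.hom _ _).symm
    exact Finset.sum_congr rfl fun j _ => (Category.assoc _ _ _).symm.trans (hlin _ _).symm

/-- Every finitely generated right `End T`-module is a quotient of `Hom(T, X)` for a finite direct
sum `X` of copies of `T`. -/
lemma exists_surjective_hom [HasFiniteBiproducts C] (M : Type v) [AddCommGroup M]
    [Module (End T)ᵐᵒᵖ M] [Module.Finite (End T)ᵐᵒᵖ M] :
    ∃ (X : C) (_ : addClosure T X) (q : (preadditiveCoyonedaObj T).obj X →ₗ[(End T)ᵐᵒᵖ] M),
      Function.Surjective q := by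
  obtain ⟨n, f, hf⟩ := Module.Finite.exists_fin' (End T)ᵐᵒᵖ M
  let b : Bicone fun _ : Fin n => T := biproduct.bicone fun _ => T
  have hb : b.IsBilimit := biproduct.isBilimit _
  -- The identification of `Hom(T, T ^ n)` with the free module of rank `n`.
  let π : (preadditiveCoyonedaObj T).obj b.pt →ₗ[(End T)ᵐᵒᵖ] (Fin n → (End T)ᵐᵒᵖ) :=
    { toFun := fun g j => MulOpposite.op (End.of ((show T ⟶ b.pt from g) ≫ b.π j))
      map_add' := fun x y => by
        funext j
        exact congrArg MulOpposite.op (Preadditive.add_comp _ _ _ _ _ _)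
      map_smul' := fun c x => by
        funext j
        exact congrArg MulOpposite.op (Category.assoc _ _ _) }
  refine ⟨b.pt, ⟨n, b, ⟨hb⟩, ⟨Retract.refl _⟩⟩, f ∘ₗ π, hf.comp fun c => ?_⟩
  refine ⟨(∑ j, (show T ⟶ T from (c j).unop) ≫ b.ι j : T ⟶ b.pt), funext fun k => ?_⟩
  apply MulOpposite.unop_injective
  change (∑ j, (show T ⟶ T from (c j).unop) ≫ b.ι j : T ⟶ b.pt) ≫ b.π k = (c k).unop
  rw [Preadditive.sum_comp, Finset.sum_eq_single k]
  · rw [Category.assoc, bicone_ι_π_self, Category.comp_id]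
  · intro j _ hj
    rw [Category.assoc, bicone_ι_π_ne _ hj, comp_zero]
  · simp

lemma addClosure_of_retract {X Y : C} (hY : addClosure T Y) (r : Retract X Y) :
    addClosure T X := by
  obtain ⟨n, b, hb, ⟨e⟩⟩ := hY
  exact ⟨n, b, hb, ⟨r.trans e⟩⟩

instance : (homProj T).Faithful where
  map_injective {X Y f g} h := by
    refine ObjectProperty.hom_ext _ ((bijective_preadditiveCoyonedaObj_map X.property _).1 ?_)
    exact congrArg (fun k => k.hom.hom) h

instance : (homProj T).Full where
  map_surjective {X Y} φ := by
    obtain ⟨f, hf⟩ := (bijective_preadditiveCoyonedaObj_map X.property Y.obj).2 φ.hom.hom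
    exact ⟨ObjectProperty.homMk f,
      ObjectProperty.hom_ext _ (ObjectProperty.hom_ext _ hf)⟩

/-- A finitely generated projective module is cut out of some `Hom(T, Y)` by an idempotent, which
comes from an idempotent of `Y`; the image of the latter is the required object. -/
instance [HasFiniteBiproducts C] [IsIdempotentComplete C] : (homProj T).EssSurj where
  mem_essImage M := by
    have : Module.Projective (End T)ᵐᵒᵖ M.obj := M.property
    obtain ⟨Y, hY, q, hq⟩ := exists_surjective_hom (T := T) M.obj
    obtain ⟨s, hs⟩ := Module.projective_lifting_property q LinearMap.id hq
    have hsq : ∀ x, q (s x) = x := LinearMap.congr_fun hs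
    obtain ⟨ε, hε⟩ := (bijective_preadditiveCoyonedaObj_map hY Y).2 (ModuleCat.ofHom (s ∘ₗ q))
    have hε' : ∀ g : T ⟶ Y, (g ≫ ε : T ⟶ Y) = s (q g) := fun g =>
      LinearMap.congr_fun (congrArg ModuleCat.Hom.hom hε) g
    have hid : ε ≫ ε = ε := by
      refine (bijective_preadditiveCoyonedaObj_map hY Y).1
        (ModuleCat.hom_ext (LinearMap.ext fun (g : T ⟶ Y) => ?_))
      change (g ≫ ε ≫ ε : T ⟶ Y) = g ≫ ε
      rw [← Category.assoc, hε', hε']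
      exact congrArg s (hsq _)
    obtain ⟨X, i, r, hir, hri⟩ := IsIdempotentComplete.idempotents_split Y ε hid
    have hX : addClosure T X := addClosure_of_retract hY ⟨i, r, hir⟩
    let e : (preadditiveCoyonedaObj T).obj X ≃ₗ[(End T)ᵐᵒᵖ] M.obj :=
      LinearEquiv.ofLinearMap (q ∘ₗ ((preadditiveCoyonedaObj T).map i).hom)
        (((preadditiveCoyonedaObj T).map r).hom ∘ₗ s)
        (LinearMap.ext fun x => by
          change q (((show T ⟶ Y from s x) ≫ r) ≫ i : T ⟶ Y) = x
          rw [Category.assoc, hri, hε', hsq, hsq])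
        (LinearMap.ext fun (g : T ⟶ X) => by
          change (show T ⟶ Y from s (q (g ≫ i : T ⟶ Y))) ≫ r = g
          rw [← hε', ← hri]
          simp [hir])
    exact ⟨⟨X, hX⟩, ⟨ObjectProperty.isoMk _ (ObjectProperty.isoMk _ e.toModuleIso)⟩⟩

lemma isEquivalence_homProj [HasFiniteBiproducts C] [IsIdempotentComplete C] (T : C) :
    (homProj T).IsEquivalence where

end AddClosure

/-! ### Resolutions over the endomorphism ring of a cluster tilting object -/

section ClusterTilting

variable {C : Type u} [Category.{v} C] [Abelian C]

lemma IsClusterTilting.prop_of_projective {d : ℕ} {P : ObjectProperty C}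
    (hP : IsClusterTilting d P) (Q : C) [Projective Q] : P Q := by
  refine (hP.mem_iff_ext_from Q).2 fun t _ i hi _ => ?_
  obtain ⟨j, rfl⟩ := Nat.exists_eq_add_of_le' hi
  let := HasExt.standard C
  exact Abelian.Ext.subsingleton_of_projective Q t j

/-- Right approximations are epimorphisms, since an epimorphism from a projective object factors
through them. -/
lemma IsClusterTilting.exists_epi_approximation [EnoughProjectives C] {d : ℕ}
    {P : ObjectProperty C} (hP : IsClusterTilting d P) (a : C) :
    ∃ (t : C) (f : t ⟶ a), P t ∧ Epi f ∧
      ∀ (t' : C) (g : t' ⟶ a), P t' → ∃ h : t' ⟶ t, h ≫ f = g := by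
  obtain ⟨t, f, ht, hf⟩ := hP.contravariantlyFinite a
  obtain ⟨h, hh⟩ := hf _ (Projective.π a) (hP.prop_of_projective _)
  have : Epi (h ≫ f) := hh ▸ inferInstance
  exact ⟨t, f, ht, epi_of_epi h f, hf⟩

/-- Dimension shifting along a short exact sequence; in degree one the hypothesis is that the
epimorphism has the lifting property of a right approximation. -/
lemma extVanishes_succ_of_approximation {S : ShortComplex C} (hS : S.ShortExact) {s : C} {i : ℕ}
    (hlift : i = 0 → ∀ g : s ⟶ S.X₃, ∃ h : s ⟶ S.X₂, h ≫ S.g = g)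
    (h₃ : 1 ≤ i → ExtVanishes s S.X₃ i) (h₂ : ExtVanishes s S.X₂ (i + 1)) :
    ExtVanishes s S.X₁ (i + 1) := by
  let := HasExt.standard C
  have h₂' : Subsingleton (Abelian.Ext.{max u v} s S.X₂ (i + 1)) := h₂
  refine subsingleton_of_forall_eq 0 fun x => ?_
  obtain ⟨y, rfl⟩ := Abelian.Ext.covariant_sequence_exact₁ s hS x (Subsingleton.elim _ _) rfl
  obtain rfl | hi := Nat.eq_zero_or_pos i
  · -- In degree zero, the connecting map vanishes on morphisms that lift.
    obtain ⟨g, rfl⟩ := (Abelian.Ext.mk₀_bijective _ _).2 y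
    obtain ⟨h, rfl⟩ := hlift rfl g
    rw [← Abelian.Ext.mk₀_comp_mk₀, Abelian.Ext.comp_assoc_of_second_deg_zero,
      hS.comp_extClass, Abelian.Ext.comp_zero]
  · have h₃' : Subsingleton (Abelian.Ext.{max u v} s S.X₃ i) := h₃ hi
    rw [Subsingleton.elim y 0, Abelian.Ext.zero_comp]

lemma finite_hom_of_contravariantlyFinite {T : C} (hT : ContravariantlyFinite (addClosure T))
    (hTT : addClosure T T) (a : C) :
    Module.Finite (End T)ᵐᵒᵖ ((preadditiveCoyonedaObj T).obj a) := by
  obtain ⟨t, f, ht, hf⟩ := hT a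
  have := finite_hom T t ht
  exact Module.Finite.of_surjective ((preadditiveCoyonedaObj T).map f).hom fun g => hf T g hTT

lemma addClosure_self (T : C) : addClosure T T :=
  ⟨1, biproduct.bicone _, ⟨biproduct.isBilimit _⟩,
    ⟨⟨biproduct.ι (fun _ : Fin 1 => T) 0, biproduct.π (fun _ : Fin 1 => T) 0,
      biproduct.ι_π_self _ _⟩⟩⟩

variable {T : C} [IsNoetherianRing (End T)ᵐᵒᵖ]

/-- If `Ext^i(add T, a) = 0` for `1 ≤ i ≤ k`, then the kernel of an approximation of `a` satisfies
this for `k + 1`. So after `m ≥ d - 1 - k` approximations the kernel is in `add T`, and applying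
`Hom(T, -)` to all of them gives a projective resolution of `Hom(T, a)` of length `m`. -/
lemma exists_isEulerClass_hom [EnoughProjectives C] {d : ℕ}
    (hT : IsClusterTilting d (addClosure T)) (m k : ℕ) (hmk : d ≤ k + m + 1) (a : C)
    (ha : ∀ s, addClosure T s → ∀ i, 1 ≤ i → i ≤ k → i + 1 ≤ d → ExtVanishes s a i)
    (hfin : Module.Finite (End T)ᵐᵒᵖ ((preadditiveCoyonedaObj T).obj a)) :
    ∃ x, IsEulerClass (isProj (End T)ᵐᵒᵖ) m
      ⟨(preadditiveCoyonedaObj T).obj a, hfin⟩ x := by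
  induction m generalizing k a with
  | zero =>
    have h : addClosure T a := (hT.mem_iff_ext_to a).2 fun t ht i hi hid =>
      ha t ht i hi (by omega) hid
    exact ⟨_, projective_hom T a h, rfl⟩
  | succ m ih =>
    obtain ⟨t, f, ht, hf, happ⟩ := hT.exists_epi_approximation a
    let S : ShortComplex C := ShortComplex.mk (kernel.ι f) f (kernel.condition f)
    have hS : S.ShortExact :=
      { exact := ShortComplex.exact_of_f_is_kernel _ (kernelIsKernel f)
        mono_f := inferInstanceAs (Mono (kernel.ι f))
        epi_g := hf }
    have hfin' := finite_hom_of_contravariantlyFinite hT.contravariantlyFinite (addClosure_self T)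
      (kernel f)
    obtain ⟨x, hx⟩ := ih (k + 1) (by omega) (kernel f) (fun s hs i hi hik hid => by
      obtain ⟨j, rfl⟩ := Nat.exists_eq_add_of_le' hi
      refine extVanishes_succ_of_approximation hS (fun _ g => happ s g hs)
        (fun hj => ha s hs j hj (by omega) (by omega)) ?_
      exact (hT.mem_iff_ext_to t).1 ht s hs _ hi hid) hfin'
    let F : FGModuleCat.{v} (End T)ᵐᵒᵖ := ⟨(preadditiveCoyonedaObj T).obj t, finite_hom T t ht⟩
    let N : FGModuleCat.{v} (End T)ᵐᵒᵖ := ⟨(preadditiveCoyonedaObj T).obj a, hfin⟩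
    let K : FGModuleCat.{v} (End T)ᵐᵒᵖ := ⟨(preadditiveCoyonedaObj T).obj (kernel f), hfin'⟩
    let i' : K ⟶ F := ObjectProperty.homMk ((preadditiveCoyonedaObj T).map (kernel.ι f))
    let p' : F ⟶ N := ObjectProperty.homMk ((preadditiveCoyonedaObj T).map f)
    have w : i' ≫ p' = 0 := by
      refine ObjectProperty.hom_ext _ ?_
      change (preadditiveCoyonedaObj T).map (kernel.ι f) ≫ (preadditiveCoyonedaObj T).map f = 0
      rw [← Functor.map_comp, kernel.condition, Functor.map_zero]
    refine ⟨_, K, F, i', p', w, projective_hom T t ht, x, ?_, hx, rfl⟩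
    refine FGModuleCat.shortExact w (fun g h hgh => ?_) (fun g => happ T g (addClosure_self T))
      fun g hg => ⟨kernel.lift f g hg, kernel.lift_ι _ _ _⟩
    exact (cancel_mono (kernel.ι f)).1 hgh

/-- A presentation of a module by modules of the form `Hom(T, t)` has the kernel `Hom(T, a)`, with
`a` the kernel of the corresponding morphism in `add T`. -/
lemma exists_isEulerClass [EnoughProjectives C] {d : ℕ} (hd : 1 ≤ d)
    (hT : IsClusterTilting d (addClosure T)) (M : FGModuleCat.{v} (End T)ᵐᵒᵖ) :
    ∃ x, IsEulerClass (isProj (End T)ᵐᵒᵖ) (d + 1) M x := by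
  have := Abelian.hasFiniteBiproducts (C := C)
  obtain ⟨d, rfl⟩ := Nat.exists_eq_add_of_le' hd
  obtain ⟨t₀, h₀, q₀, hq₀⟩ := exists_surjective_hom (T := T) M
  have hf₀ := finite_hom T t₀ h₀
  obtain ⟨t₁, h₁, q₁, hq₁⟩ := exists_surjective_hom (T := T) (LinearMap.ker q₀)
  obtain ⟨f, hf⟩ := (bijective_preadditiveCoyonedaObj_map h₁ t₀).2
    (ModuleCat.ofHom ((LinearMap.ker q₀).subtype ∘ₗ q₁))
  have hf' : ∀ g : T ⟶ t₁, (g ≫ f : T ⟶ t₀) = (q₁ g : (preadditiveCoyonedaObj T).obj t₀) :=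
    fun g => LinearMap.congr_fun (congrArg ModuleCat.Hom.hom hf) g
  have hfin := finite_hom_of_contravariantlyFinite hT.contravariantlyFinite (addClosure_self T)
    (kernel f)
  obtain ⟨x, hx⟩ := exists_isEulerClass_hom hT d 0 (by omega) (kernel f)
    (fun s hs i hi hi' => by omega) hfin
  let F₀ : FGModuleCat.{v} (End T)ᵐᵒᵖ := ⟨(preadditiveCoyonedaObj T).obj t₀, hf₀⟩
  let F₁ : FGModuleCat.{v} (End T)ᵐᵒᵖ := ⟨(preadditiveCoyonedaObj T).obj t₁, finite_hom T t₁ h₁⟩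
  let K₀ : FGModuleCat.{v} (End T)ᵐᵒᵖ := FGModuleCat.of _ (LinearMap.ker q₀)
  let K₁ : FGModuleCat.{v} (End T)ᵐᵒᵖ := ⟨(preadditiveCoyonedaObj T).obj (kernel f), hfin⟩
  let i₁ : K₁ ⟶ F₁ := ObjectProperty.homMk ((preadditiveCoyonedaObj T).map (kernel.ι f))
  let p₁ : F₁ ⟶ K₀ := ObjectProperty.homMk (ModuleCat.ofHom q₁)
  let i₀ : K₀ ⟶ F₀ := ObjectProperty.homMk (ModuleCat.ofHom (LinearMap.ker q₀).subtype)
  let p₀ : F₀ ⟶ M := ObjectProperty.homMk (ModuleCat.ofHom q₀)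
  have w₁ : i₁ ≫ p₁ = 0 := by
    refine FGModuleCat.hom_ext (LinearMap.ext fun (g : T ⟶ kernel f) => Subtype.ext ?_)
    refine (hf' (g ≫ kernel.ι f)).symm.trans ?_
    rw [Category.assoc, kernel.condition, comp_zero]
    rfl
  have w₀ : i₀ ≫ p₀ = 0 := FGModuleCat.hom_ext (LinearMap.ext fun y => y.2)
  refine ⟨_, K₀, F₀, i₀, p₀, w₀, projective_hom T t₀ h₀, _, ?_,
    ⟨K₁, F₁, i₁, p₁, w₁, projective_hom T t₁ h₁, x, ?_, hx, rfl⟩, rfl⟩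
  · exact FGModuleCat.shortExact w₀ Subtype.val_injective hq₀ fun y hy => ⟨⟨y, hy⟩, rfl⟩
  · refine FGModuleCat.shortExact w₁ (fun g h hgh => (cancel_mono (kernel.ι f)).1 hgh) hq₁
      fun g hg => ⟨kernel.lift f g ?_, kernel.lift_ι _ _ _⟩
    exact (hf' g).trans (congrArg Subtype.val hg)

end ClusterTilting

/-! ### The case of modules over a finite-dimensional algebra -/

/-- The endomorphism ring of a finitely generated module over a finite-dimensional algebra is
finite-dimensional, hence Noetherian. -/
lemma isNoetherianRing_end {K : Type w} {Φ : Type u} [Field K] [Ring Φ] [Algebra K Φ]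
    [FiniteDimensional K Φ] (T : FGModuleCat.{u} Φᵐᵒᵖ) : IsNoetherianRing (End T)ᵐᵒᵖ := by
  let : Module K T := Module.compHom T (algebraMap K Φᵐᵒᵖ)
  have : IsScalarTower K Φᵐᵒᵖ T := IsScalarTower.of_algebraMap_smul fun _ _ => rfl
  have : Module.Finite K T := Module.Finite.trans Φᵐᵒᵖ T
  have : SMulCommClass Φᵐᵒᵖ K T := IsScalarTower.to_smulCommClass'
  have : Module.Finite K (Module.End Φᵐᵒᵖ T) :=
    Module.Finite.of_injective (LinearMap.restrictScalarsₗ K Φᵐᵒᵖ T T K)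
      (LinearMap.restrictScalars_injective K)
  have : IsNoetherianRing (Module.End Φᵐᵒᵖ T)ᵐᵒᵖ := IsNoetherianRing.of_finite K _
  let e : Module.End Φᵐᵒᵖ T ≃+* End T :=
    { toFun := fun f => End.of (FGModuleCat.ofHom f)
      invFun := fun f => (show T ⟶ T from f).hom.hom
      left_inv := fun _ => rfl
      right_inv := fun _ => rfl
      map_mul' := fun _ _ => rfl
      map_add' := fun _ _ => rfl }
  exact isNoetherianRing_of_ringEquiv _ (RingEquiv.op e)

end HigherAuslander

theorem mainTheorem6 {K : Type w} {Φ : Type u} [Field K] [IsAlgClosed K] [Ring Φ] [Algebra K Φ]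
    [FiniteDimensional K Φ] (d : ℕ) (hd : 1 ≤ d) (T : FGModuleCat.{u} Φᵐᵒᵖ)
    (hT : haveI : IsNoetherianRing Φᵐᵒᵖ := IsNoetherianRing.of_finite K Φᵐᵒᵖ
      HigherAuslander.IsClusterTilting d (HigherAuslander.addClosure T)) :
    (HigherAuslander.homProj T).IsEquivalence ∧
    Function.Bijective (HigherAuslander.rho (End T)ᵐᵒᵖ) ∧
    Function.Bijective (HigherAuslander.kappa T) ∧
    ∀ t : (HigherAuslander.addClosure T).FullSubcategory,
      HigherAuslander.kappa T (HigherAuslander.K0sp.of t) =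
        HigherAuslander.K0.of ((HigherAuslander.homMod T).obj t) := by
  have : IsNoetherianRing Φᵐᵒᵖ := IsNoetherianRing.of_finite K Φᵐᵒᵖ
  have : IsNoetherianRing (End T)ᵐᵒᵖ := HigherAuslander.isNoetherianRing_end (K := K) T
  have := Abelian.hasFiniteBiproducts (C := FGModuleCat.{u} Φᵐᵒᵖ)
  have hE : (HigherAuslander.homProj T).IsEquivalence := HigherAuslander.isEquivalence_homProj T
  have hρ : Function.Bijective (HigherAuslander.rho (End T)ᵐᵒᵖ) :=
    HigherAuslander.bijective_proj_comp_map HigherAuslander.isProj_iff_projective (d + 1)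
      (HigherAuslander.exists_isEulerClass hd hT)
  exact ⟨hE, hρ,
    hρ.comp (HigherAuslander.K0sp.bijective_map_of_isEquivalence (HigherAuslander.homProj T)),
    fun _ => rfl⟩
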